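/- Fix an infinite set of variables. An inclusion atom $\vec x\subseteq\vec y$ is given by two finite tuples of variables of the same length, and a conditional independence atom $\vec y\perp_{\vec x}\vec z$ by three finite tuples of variables (repetitions, overlaps and empty tuples are allowed). A team $X$ over a nonempty set $M$ is a set of assignments $s:D\to M$ with a common finite domain $D=\mathrm{Dom}(X)$ of variables. For a team whose domain contains the variables of the atom, - $X\models\vec x\subseteq\vec y$ iff for every $s\in X$ there is $s'\in X$ with $s(\vec x)=s'(\vec y)$; - $X\models\vec y\perp_{\vec x}\vec z$ iff for all $s,s'\in X$ with $s(\vec x)=s'(\vec x)$ there is $s''\in X$ with $s''(\vec x)=s(\vec x)$, $s''(\vec y)=s(\vec y)$ and $s''(\vec z)=s'(\vec z)$. For a finite set $\Sigma\cup\{\phi\}$ of such atoms, $\Sigma\models\phi$ means that every team $X$ (over any nonempty set $M$) whose domain contains all variables of $\Sigma\cup\{\phi\}$ and which satisfies every atom of $\Sigma$ also satisfies $\phi$. The formulas of the deduction system are built from atoms by conjunction. Its axioms and rules are introduction and elimination of conjunction, and the following, where juxtaposition of tuples is concatenation and where in the Start Axiom, the Chase Rule and the Final Rule corresponding tuples have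 equal lengths ($|\vec c|=|\vec x|$ in the Start Axiom and the Final Rule; $|\vec a|=|\vec x|$, $|\vec b|=|\vec y|$, $|\vec c|=|\vec z|$ in the Chase Rule): 1. Reflexivity: $\vec x\subseteq\vec x$. 2. Projection and Permutation: if $x_1\ldots x_n\subseteq y_1\ldots y_n$, then $x_{i_1}\ldots x_{i_k}\subseteq y_{i_1}\ldots y_{i_k}$, for each finite sequence $i_1,\ldots,i_k$ of elements of $\{1,\ldots,n\}$. 3. Transitivity: if $\vec x\subseteq\vec y\wedge\vec y\subseteq\vec z$, then $\vec x\subseteq\vec z$. 4. Identity Rule: if $ab\subseteq cc\wedge\psi$, then $\psi'$, where $\psi'$ is obtained from $\psi$ by replacing any number of occurrences of $a$ by $b$. 5. Inclusion Introduction: if $\vec a\subseteq\vec b$, then $\vec a x\subseteq\vec b c$, where $x$ is a new variable. 6. Start Axiom: $\vec a\vec c\subseteq\vec a\vec x\wedge\vec b\perp_{\vec a}\vec x\wedge\vec a\vec x\subseteq\vec a\vec c$, where $\vec x$ is a sequence of pairwise distinct new variables. 7. Chase Rule: if $\vec y\perp_{\vec x}\vec z\wedge\vec a\vec b\subseteq\vec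 x\vec y\wedge\vec a\vec c\subseteq\vec x\vec z$, then $\vec a\vec b\vec c\subseteq\vec x\vec y\vec z$. 8. Final Rule: if $\vec a\vec c\subseteq\vec a\vec x\wedge\vec b\perp_{\vec a}\vec x\wedge\vec a\vec b\vec x\subseteq\vec a\vec b\vec c$, then $\vec b\perp_{\vec a}\vec c$. A deduction from $\Sigma$ is a finite sequence of formulas $(\phi_1,\ldots,\phi_n)$ in which each $\phi_i$ is an element of $\Sigma$, an instance of Reflexivity or of the Start Axiom, or follows from formulas in $\Sigma\cup\{\phi_1,\ldots,\phi_{i-1}\}$ by one of the rules; the new variable $x$ (respectively the new variables $\vec x$) of a step by Inclusion Introduction (respectively the Start Axiom) must occur neither in $\Sigma\cup\{\phi_1,\ldots,\phi_{i-1}\}$ nor elsewhere in the step itself, that is, $x\neq c$ (respectively no variable of $\vec x$ occurs in $\vec a$, $\vec b$ or $\vec c$). We write $\Sigma\vdash\phi$ if there is a deduction $(\phi_1,\ldots,\phi_n)$ from $\Sigma$ with $n\ge 1$ and $\phi_n=\phi$ such that no variable of $\phi$ is a new variable of one of its steps. **Theorem (Completeness).** Let $\Sigma\cup\{\phi\}$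 be a finite set of conditional independence atoms and inclusion atoms. If $\Sigma\models\phi$, then $\Sigma\vdash\phi$. -/

import Mathlib

universe u w

namespace IndInc

/-- Inclusion atoms `x ⊆ y` (tuples of the same length, repetitions allowed) and conditional
independence atoms `y ⊥_x z` (arbitrary finite tuples) over the variables `V`. -/
inductive Atom (V : Type u) : Type u
  | inc (x y : List V) (h : x.length = y.length) : Atom V
  | ind (x y z : List V) : Atom V

/-- The formulas that occur in deductions: atoms, closed under conjunction. -/
inductive Formula (V : Type u) : Type u
  | atom (A : Atom V) : Formula V
  | and (φ ψ : Formula V) : Formula V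

/-- The set of variables occurring in an atom. -/
def Atom.vars {V : Type u} : Atom V → Set V
  | .inc x y _ => {v | v ∈ x ∨ v ∈ y}
  | .ind x y z => {v | v ∈ x ∨ v ∈ y ∨ v ∈ z}

/-- The set of variables occurring in a formula. -/
def Formula.vars {V : Type u} : Formula V → Set V
  | .atom A => A.vars
  | .and φ ψ => φ.vars ∪ ψ.vars

/-- The inclusion atom `x ⊆ y` as a formula. -/
abbrev Inc {V : Type u} (x y : List V) (h : x.length = y.length) : Formula V :=
  .atom (.inc x y h)

/-- The conditional independence atom `y ⊥_x z` as a formula; the condition comes first. -/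
abbrev Ind {V : Type u} (x y z : List V) : Formula V :=
  .atom (.ind x y z)

/-! ### Team semantics -/

/-- A team with values in `M`: a finite domain of variables, and a set of assignments from that
domain to `M`. -/
structure Team (V : Type u) (M : Type w) where
  dom : Finset V
  assignments : Set (dom → M)

open Classical in
/-- The value of the variable `v` under the assignment `s`; `none` if `v` is outside the domain. -/
noncomputable def val {V : Type u} {M : Type w} {D : Finset V} (s : D → M) (v : V) : Option M :=
  if h : v ∈ D then some (s ⟨v, h⟩) else none

/-- Satisfaction of an atom by a team. It is only used for teams whose domain contains the
variables of the atom. -/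
def Team.Sat {V : Type u} {M : Type w} (X : Team V M) : Atom V → Prop
  | .inc x y _ =>
      ∀ s ∈ X.assignments, ∃ s' ∈ X.assignments, x.map (val s) = y.map (val s')
  | .ind x y z =>
      ∀ s ∈ X.assignments, ∀ s' ∈ X.assignments, x.map (val s) = x.map (val s') →
        ∃ s'' ∈ X.assignments, x.map (val s'') = x.map (val s) ∧
          y.map (val s'') = y.map (val s) ∧ z.map (val s'') = z.map (val s')

/-- Logical consequence: every team, over any nonempty set of values, whose domain contains all
variables of `S` and `φ` and which satisfies all atoms of `S`, satisfies `φ`. -/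
def Entails {V : Type u} (S : Finset (Atom V)) (φ : Atom V) : Prop :=
  ∀ (M : Type w) [Nonempty M] (X : Team V M),
    (∀ A ∈ S, A.vars ⊆ ↑X.dom) → φ.vars ⊆ ↑X.dom → (∀ A ∈ S, X.Sat A) → X.Sat φ

/-! ### The deduction system -/

/-- `t` arises from the tuple `s` by replacing some (possibly no, possibly all) occurrences of
`a` by `b`. -/
def ReplTuple {V : Type u} (a b : V) (s t : List V) : Prop :=
  List.Forall₂ (fun p q => q = p ∨ (p = a ∧ q = b)) s t

/-- `Repl a b φ ψ`: the formula `ψ` arises from `φ` by replacing any number of occurrences of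
`a` by `b`. -/
inductive Repl {V : Type u} (a b : V) : Formula V → Formula V → Prop
  | inc {x y x' y' : List V} (h : x.length = y.length) (h' : x'.length = y'.length) :
      ReplTuple a b x x' → ReplTuple a b y y' → Repl a b (Inc x y h) (Inc x' y' h')
  | ind {x y z x' y' z' : List V} :
      ReplTuple a b x x' → ReplTuple a b y y' → ReplTuple a b z z' →
      Repl a b (Ind x y z) (Ind x' y' z')
  | and {φ ψ φ' ψ' : Formula V} :
      Repl a b φ φ' → Repl a b ψ ψ' → Repl a b (.and φ ψ) (.and φ' ψ')

/-- `Rule G φ N`: the formula `φ` is an axiom, or follows from formulas in `G` by one application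
of a rule, where `N` lists the new variables of that application. New variables do not occur
elsewhere in the axiom or rule; that they do not occur in `G` either is required in `Deduction`. -/
inductive Rule {V : Type u} (G : Set (Formula V)) : Formula V → List V → Prop
  | andIntro {φ ψ : Formula V} : φ ∈ G → ψ ∈ G → Rule G (.and φ ψ) []
  | andLeft {φ ψ : Formula V} : .and φ ψ ∈ G → Rule G φ []
  | andRight {φ ψ : Formula V} : .and φ ψ ∈ G → Rule G ψ []
  | reflexivity (x : List V) : Rule G (Inc x x rfl) []
  | projection {x y : List V} {h : x.length = y.length} (i : List (Fin x.length)) :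
      Inc x y h ∈ G →
      Rule G (Inc (i.map fun j => x.get j) (i.map fun j => y.get (j.cast h)) (by simp)) []
  | transitivity {x y z : List V} {h₁ : x.length = y.length} {h₂ : y.length = z.length} :
      .and (Inc x y h₁) (Inc y z h₂) ∈ G → Rule G (Inc x z (h₁.trans h₂)) []
  | identity {a b c : V} {φ φ' : Formula V} :
      .and (Inc [a, b] [c, c] rfl) φ ∈ G → Repl a b φ φ' → Rule G φ' []
  | inclusionIntro {a b : List V} {h : a.length = b.length} (x c : V) :
      x ≠ c → Inc a b h ∈ G → Rule G (Inc (a ++ [x]) (b ++ [c]) (by simp [h])) [x]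
  | start (a b c x : List V) (h : c.length = x.length) :
      x.Nodup → (∀ v ∈ x, v ∉ a ∧ v ∉ b ∧ v ∉ c) →
      Rule G (.and (Inc (a ++ c) (a ++ x) (by simp [h]))
        (.and (Ind a b x) (Inc (a ++ x) (a ++ c) (by simp [h])))) x
  | chase {x y z a b c : List V}
      (ha : a.length = x.length) (hb : b.length = y.length) (hc : c.length = z.length) :
      .and (Ind x y z) (.and (Inc (a ++ b) (x ++ y) (by simp [ha, hb]))
        (Inc (a ++ c) (x ++ z) (by simp [ha, hc]))) ∈ G →
      Rule G (Inc (a ++ b ++ c) (x ++ y ++ z) (by simp [ha, hb, hc])) []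
  | final {a b c x : List V} (h : c.length = x.length) :
      .and (Inc (a ++ c) (a ++ x) (by simp [h])) (.and (Ind a b x)
        (Inc (a ++ b ++ x) (a ++ b ++ c) (by simp [h]))) ∈ G →
      Rule G (Ind a b c) []

/-- The formulas available after the steps `l` of a deduction from `S`. -/
def available {V : Type u} (S : Finset (Atom V)) (l : List (Formula V)) : Set (Formula V) :=
  {ψ | (∃ A ∈ S, ψ = .atom A) ∨ ψ ∈ l}

/-- `Deduction S l N`: the sequence `l` is a deduction from `S`, and `N` is the set of the new
variables of its steps. -/
inductive Deduction {V : Type u} (S : Finset (Atom V)) : List (Formula V) → Set V → Prop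
  | nil : Deduction S [] ∅
  | hyp {l : List (Formula V)} {N : Set V} {A : Atom V} :
      Deduction S l N → A ∈ S → Deduction S (l ++ [.atom A]) N
  | rule {l : List (Formula V)} {N : Set V} {φ : Formula V} {x : List V} :
      Deduction S l N → Rule (available S l) φ x →
      (∀ v ∈ x, ∀ ψ ∈ available S l, v ∉ ψ.vars) →
      Deduction S (l ++ [φ]) (N ∪ {v | v ∈ x})

/-- `φ` is provable from `S`: some deduction from `S` ends in `φ`, and no variable of `φ` is new
in that deduction. -/
def Provable {V : Type u} (S : Finset (Atom V)) (φ : Atom V) : Prop :=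
  ∃ (l : List (Formula V)) (N : Set V),
    Deduction S (l ++ [.atom φ]) N ∧ Disjoint φ.vars N

end IndInc

namespace IndInc

/-! A team deciding the atom is read off from deductions. Let `D` hold the variables of the
hypotheses and the goal, and let `C ⊇ D` be countably infinite. For a theory closed under the rules
without new variables, consider the tuples from `C` provably included in the tuple `D`, and identify
variables `a`, `b` when some `ab ⊆ cc` is in the theory. If every inclusion of variables of `C` in
variables of `D` prolongs to all of `D` (saturation), this team satisfies all atoms of the theory
over `D`: Transitivity handles inclusions, the Chase Rule independence. Conversely, Reflexivity puts
the identity tuple into the team, so a satisfied inclusion over `D` lies in the theory; for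
independence the Start Axiom and the Final Rule do the same.

Deductions cannot simply be merged, as their new variables may clash, and `V` may be uncountable.
Hence forcing: conditions are deductions whose new variables avoid `D`, and a formula is forced when
it becomes available densely often. Rules are finitary, so forced formulas are closed under rules
without new variables. Inclusion Introduction makes each prolongation dense, and an ideal meeting
countably many dense sets has a saturated theory. Each of its members is forced by a single
condition, hence occurs in a finite deduction whose new variables avoid `D`. -/

variable {V : Type u}

/-! ### Inclusions presented as lists of pairs -/

/-- The inclusion atom whose `i`-th left and right variables are the components of `p[i]`. -/
def pairInc (p : List (V × V)) : Formula V :=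
  Inc (p.map Prod.fst) (p.map Prod.snd) (by simp)

theorem pairInc_eq {p : List (V × V)} {x y : List V} (h : x.length = y.length)
    (hx : p.map Prod.fst = x) (hy : p.map Prod.snd = y) : pairInc p = Inc x y h := by
  subst hx hy
  rfl

theorem pairInc_zip {x y : List V} (h : x.length = y.length) : pairInc (x.zip y) = Inc x y h :=
  pairInc_eq h (List.map_fst_zip h.le) (List.map_snd_zip h.ge)

/-! ### Rules depend on finitely many premises -/

theorem Rule.mono {G G' : Set (Formula V)} (hG : G ⊆ G') {φ : Formula V} {N : List V}
    (h : Rule G φ N) : Rule G' φ N := by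
  cases h with
  | andIntro h₁ h₂ => exact .andIntro (hG h₁) (hG h₂)
  | andLeft h => exact .andLeft (hG h)
  | andRight h => exact .andRight (hG h)
  | reflexivity x => exact .reflexivity x
  | projection i h => exact .projection i (hG h)
  | transitivity h => exact .transitivity (hG h)
  | identity h hr => exact .identity (hG h) hr
  | inclusionIntro x c hx h => exact .inclusionIntro x c hx (hG h)
  | start a b c x h hn hx => exact .start a b c N h hn hx
  | chase ha hb hc h => exact .chase ha hb hc (hG h)
  | final h h' => exact .final h (hG h')

/-- Finiteness lets one condition supply all premises of a rule whose premises are merely forced. -/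
theorem Rule.exists_finite {G : Set (Formula V)} {φ : Formula V} {N : List V}
    (h : Rule G φ N) : ∃ F ⊆ G, F.Finite ∧ Rule F φ N := by
  have one : ∀ {ψ : Formula V}, ψ ∈ G → (Rule {ψ} φ N) →
      ∃ F ⊆ G, F.Finite ∧ Rule F φ N := fun {ψ} hψ hr =>
    ⟨{ψ}, Set.singleton_subset_iff.2 hψ, Set.finite_singleton ψ, hr⟩
  cases h with
  | @andIntro φ ψ h₁ h₂ =>
    exact ⟨{φ, ψ}, Set.insert_subset h₁ (Set.singleton_subset_iff.2 h₂), by simp,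
      .andIntro (by simp) (by simp)⟩
  | andLeft h => exact one h (.andLeft rfl)
  | andRight h => exact one h (.andRight rfl)
  | reflexivity x => exact ⟨∅, Set.empty_subset _, Set.finite_empty, .reflexivity x⟩
  | projection i h => exact one h (.projection i rfl)
  | transitivity h => exact one h (.transitivity rfl)
  | identity h hr => exact one h (.identity rfl hr)
  | inclusionIntro x c hx h => exact one h (.inclusionIntro x c hx rfl)
  | start a b c x h hn hx =>
    exact ⟨∅, Set.empty_subset _, Set.finite_empty, .start a b c N h hn hx⟩
  | chase ha hb hc h => exact one h (.chase ha hb hc rfl)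
  | final h h' => exact one h' (.final h rfl)

/-! ### Theories closed under the rules without new variables -/

/-- Closure under all applications of rules that introduce no new variables. -/
def Closed (G : Set (Formula V)) : Prop :=
  ∀ φ, Rule G φ [] → φ ∈ G

/-- Provable equality of two variables: `ab ⊆ cc` for some `c`. -/
def Eqv (G : Set (Formula V)) (a b : V) : Prop :=
  ∃ c, pairInc [(a, c), (b, c)] ∈ G

namespace Closed

variable {G : Set (Formula V)}

theorem and_mem (hG : Closed G) {φ ψ : Formula V} (h₁ : φ ∈ G) (h₂ : ψ ∈ G) : .and φ ψ ∈ G :=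
  hG _ (.andIntro h₁ h₂)

theorem refl (hG : Closed G) (x : List V) : pairInc (x.map fun v => (v, v)) ∈ G := by
  rw [pairInc_eq (x := x) (y := x) rfl (by simp [Function.comp_def]) (by simp [Function.comp_def])]
  exact hG _ (.reflexivity x)

theorem proj (hG : Closed G) {p p' : List (V × V)} (hp : p' ⊆ p)
    (h : pairInc p ∈ G) : pairInc p' ∈ G := by
  have key : ∃ i : List (Fin p.length), p' = i.map p.get := by
    clear h
    induction p' with
    | nil => exact ⟨[], rfl⟩
    | cons u p' ih =>
      obtain ⟨i, rfl⟩ := ih fun v hv => hp (List.mem_cons_of_mem _ hv)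
      obtain ⟨j, rfl⟩ := List.get_of_mem (hp List.mem_cons_self)
      exact ⟨j :: i, rfl⟩
  obtain ⟨i, rfl⟩ := key
  have h' := hG _ (.projection (i.map (Fin.cast (by simp))) h)
  rw [pairInc_eq _ _ _]
  · exact h'
  · simp [Function.comp_def]
  · simp [Function.comp_def]

theorem trans (hG : Closed G) {α : Type*} {l : List α} {f g k : α → V}
    (h₁ : pairInc (l.map fun i => (f i, g i)) ∈ G)
    (h₂ : pairInc (l.map fun i => (g i, k i)) ∈ G) :
    pairInc (l.map fun i => (f i, k i)) ∈ G := by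
  rw [pairInc_eq (x := l.map f) (y := l.map g) (by simp) (by simp) (by simp)] at h₁
  rw [pairInc_eq (x := l.map g) (y := l.map k) (by simp) (by simp) (by simp)] at h₂
  rw [pairInc_eq (x := l.map f) (y := l.map k) (by simp) (by simp) (by simp)]
  exact hG _ (.transitivity (hG.and_mem h₁ h₂))

theorem replace_head (hG : Closed G) {a b c : V} {p : List (V × V)} (hab : Eqv G a b)
    (h : pairInc ((a, c) :: p) ∈ G) : pairInc ((b, c) :: p) ∈ G := by
  obtain ⟨e, he⟩ := hab
  have refl : ∀ x : List V, ReplTuple a b x x := fun x =>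
    List.forall₂_same.2 fun _ _ => Or.inl rfl
  exact hG _ (.identity (hG.and_mem he h)
    (.inc _ _ (.cons (.inr ⟨rfl, rfl⟩) (refl _)) (refl _)))

theorem replace (hG : Closed G) {α : Type*} {l : List α} {f f' k : α → V} {p : List (V × V)}
    (hf : ∀ i ∈ l, Eqv G (f i) (f' i)) (h : pairInc (l.map (fun i => (f i, k i)) ++ p) ∈ G) :
    pairInc (l.map (fun i => (f' i, k i)) ++ p) ∈ G := by
  induction l generalizing p with
  | nil => exact h
  | cons i l ih =>
    have h₁ := hG.replace_head (hf i List.mem_cons_self) h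
    -- The corrected pair joins the tail, so that the next pair becomes the head, the only place
    -- where a replacement is made.
    have h₂ := ih (p := (f' i, k i) :: p) (fun j hj => hf j (List.mem_cons_of_mem _ hj))
      (hG.proj (by intro u; simp; grind) h₁)
    exact hG.proj (by intro u; simp; grind) h₂

theorem eqv_equivalence (hG : Closed G) : Equivalence (Eqv G) where
  refl a := ⟨a, hG.refl [a, a]⟩
  symm := fun ⟨c, h⟩ => ⟨c, hG.proj (by intro u; simp; tauto) h⟩
  trans := fun ⟨c, h⟩ h' => ⟨c, hG.proj (p := [(_, c), (_, c)]) (by intro u; simp; tauto)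
    (hG.replace_head h' (hG.proj (p' := [(_, c), (_, c)]) (by intro u; simp; tauto) h))⟩

/-- The source of all provable equalities: Projection isolates two left variables over one right
variable. -/
theorem eqv_of_mem (hG : Closed G) {a b c : V} {p : List (V × V)} (h : pairInc p ∈ G)
    (ha : (a, c) ∈ p) (hb : (b, c) ∈ p) : Eqv G a b :=
  ⟨c, hG.proj (by simp [ha, hb]) h⟩

theorem chase (hG : Closed G) {x y z : List V} {f g : V → V} (h : Ind x y z ∈ G)
    (h₁ : pairInc ((x ++ y).map fun v => (f v, v)) ∈ G)
    (h₂ : pairInc (x.map (fun v => (f v, v)) ++ z.map fun v => (g v, v)) ∈ G) :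
    pairInc ((x ++ y).map (fun v => (f v, v)) ++ z.map fun v => (g v, v)) ∈ G := by
  rw [pairInc_eq (x := x.map f ++ y.map f) (y := x ++ y) (by simp)
    (by simp [Function.comp_def]) (by simp [Function.comp_def])] at h₁
  rw [pairInc_eq (x := x.map f ++ z.map g) (y := x ++ z) (by simp)
    (by simp [Function.comp_def]) (by simp [Function.comp_def])] at h₂
  rw [pairInc_eq (x := x.map f ++ y.map f ++ z.map g) (y := x ++ y ++ z) (by simp)
    (by simp [Function.comp_def]) (by simp [Function.comp_def])]
  exact hG _ (.chase (by simp) (by simp) (by simp) (hG.and_mem h (hG.and_mem h₁ h₂)))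

end Closed

/-! ### The team of a saturated theory -/

/-- Every inclusion from `C` into `D` in the theory can be prolonged to an inclusion with right
side containing `D`. -/
def Saturated (G : Set (Formula V)) (D : Finset V) (C : Set V) : Prop :=
  ∀ p : List (V × V), (∀ u ∈ p, u.1 ∈ C ∧ u.2 ∈ D) → pairInc p ∈ G →
    ∃ g : V → C, pairInc (p ++ D.toList.map fun v => ((g v : V), v)) ∈ G

/-- The assignments given by the tuples from `C` that the theory includes in the tuple `D`, up to
a naming `q` of the elements of `C`. -/
def canonicalTeam {M : Type w} (G : Set (Formula V)) (D : Finset V) (C : Set V) (q : C → M) :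
    Team V M where
  dom := D
  assignments := {s | ∃ g : V → C, pairInc (D.toList.map fun v => ((g v : V), v)) ∈ G ∧
    ∀ d, s d = q (g d)}

theorem map_val_eq {M : Type w} {D : Finset V} {s : D → M} {f : V → M} (hs : ∀ d, s d = f d)
    {x : List V} (hx : ∀ v ∈ x, v ∈ D) : x.map (val s) = x.map fun v => some (f v) := by
  refine List.map_congr_left fun v hv => ?_
  simp [val, hx v hv, hs]

theorem map_eq_map_iff {M : Type w} {f g : V → M} {x : List V} :
    (x.map fun v => some (f v)) = (x.map fun v => some (g v)) ↔ ∀ v ∈ x, f v = g v := by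
  simp

theorem map_zip_eq_iff {M : Type w} {f g : V → M} {x y : List V} (h : x.length = y.length) :
    (x.map fun v => some (f v)) = (y.map fun v => some (g v)) ↔
      ∀ u ∈ x.zip y, f u.1 = g u.2 := by
  have hx : (x.zip y).map Prod.fst = x := List.map_fst_zip h.le
  have hy : (x.zip y).map Prod.snd = y := List.map_snd_zip h.ge
  generalize x.zip y = p at hx hy
  subst hx hy
  simp

theorem zip_self (x : List V) : x.zip x = x.map fun v => (v, v) := by
  induction x with
  | nil => rfl
  | cons v x ih => simp [ih]

/-! ### Truth in the canonical team versus membership in the theory. -/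

section Canonical

variable {M : Type w} {G : Set (Formula V)} {D : Finset V} {C : Set V} {q : C → M}

theorem canonicalTeam_map_val {s : (canonicalTeam G D C q).dom → M} {g : V → C}
    (hs : ∀ d, s d = q (g d)) {x : List V} (hx : ∀ v ∈ x, v ∈ D) :
    x.map (val s) = x.map fun v => some (q (g v)) :=
  map_val_eq (D := D) (f := fun v => q (g v)) hs hx

theorem vertex_proj (hG : Closed G) {α : Type*} {g : V → V}
    (hg : pairInc (D.toList.map fun v => (g v, v)) ∈ G) {l : List α} {f : α → V}
    (hf : ∀ i ∈ l, f i ∈ D) :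
    pairInc (l.map fun i => (g (f i), f i)) ∈ G := by
  refine hG.proj (fun u hu => ?_) hg
  obtain ⟨i, hi, rfl⟩ := List.mem_map.1 hu
  exact List.mem_map.2 ⟨f i, by simpa using hf i hi, rfl⟩

/-- The prolonged inclusion repeats each right variable of `p`, which makes the old and new left
variables over it provably equal. -/
theorem Saturated.exists_vertex (hsat : Saturated G D C) (hG : Closed G) {p : List (V × V)}
    (hp : ∀ u ∈ p, u.1 ∈ C ∧ u.2 ∈ D) (h : pairInc p ∈ G) :
    ∃ g : V → C, pairInc (D.toList.map fun v => ((g v : V), v)) ∈ G ∧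
      ∀ u ∈ p, Eqv G (g u.2) u.1 := by
  obtain ⟨g, hg⟩ := hsat p hp h
  refine ⟨g, hG.proj (List.subset_append_right _ _) hg, fun u hu => ?_⟩
  refine hG.eqv_of_mem (c := u.2) hg ?_ (List.mem_append_left _ hu)
  exact List.mem_append_right _ (List.mem_map.2 ⟨u.2, by simpa using (hp u hu).2, rfl⟩)

theorem canonicalTeam_sat (hG : Closed G)
    (hq : ∀ a b : C, q a = q b ↔ Eqv G a b) (hsat : Saturated G D C) {A : Atom V}
    (hA : .atom A ∈ G) (hD : A.vars ⊆ ↑D) : (canonicalTeam G D C q).Sat A := by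
  cases A with
  | inc x y h =>
    have hx : ∀ v ∈ x, v ∈ D := fun v hv => hD (Or.inl hv)
    have hy : ∀ v ∈ y, v ∈ D := fun v hv => hD (Or.inr hv)
    rintro s ⟨g, hg, hs⟩
    have h₁ : pairInc ((x.zip y).map fun u => ((g u.1 : V), u.1)) ∈ G :=
      vertex_proj (g := fun v => (g v : V)) hG hg fun u hu => hx _ (List.of_mem_zip hu).1
    have h₂ : pairInc ((x.zip y).map fun u => (u.1, u.2)) ∈ G := by
      simpa [pairInc_zip h] using hA
    obtain ⟨g', hg', he⟩ := hsat.exists_vertex hG (by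
      intro u hu
      obtain ⟨i, hi, rfl⟩ := List.mem_map.1 hu
      exact ⟨(g i.1).2, hy _ (List.of_mem_zip hi).2⟩) (hG.trans h₁ h₂)
    refine ⟨fun d => q (g' d), ⟨g', hg', fun _ => rfl⟩, ?_⟩
    rw [canonicalTeam_map_val (g := g) hs hx,
      canonicalTeam_map_val (g := g') (fun _ => rfl) hy, map_zip_eq_iff h]
    intro u hu
    exact ((hq _ _).2 (he _ (List.mem_map_of_mem hu))).symm
  | ind x y z =>
    have hx : ∀ v ∈ x, v ∈ D := fun v hv => hD (Or.inl hv)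
    have hy : ∀ v ∈ y, v ∈ D := fun v hv => hD (Or.inr (Or.inl hv))
    have hz : ∀ v ∈ z, v ∈ D := fun v hv => hD (Or.inr (Or.inr hv))
    rintro s ⟨g, hg, hs⟩ s' ⟨g', hg', hs'⟩ hss
    rw [canonicalTeam_map_val (g := g) hs hx,
      canonicalTeam_map_val (g := g') hs' hx, map_eq_map_iff] at hss
    have h₁ : pairInc ((x ++ y).map fun v => ((g v : V), v)) ∈ G :=
      vertex_proj (f := id) (g := fun v => (g v : V)) hG hg (by
        intro v hv; exact (List.mem_append.1 hv).elim (hx v) (hy v))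
    have h₂ : pairInc ((x ++ z).map fun v => ((g' v : V), v)) ∈ G :=
      vertex_proj (f := id) (g := fun v => (g' v : V)) hG hg' (by
        intro v hv; exact (List.mem_append.1 hv).elim (hx v) (hz v))
    rw [List.map_append] at h₂
    obtain ⟨g'', hg'', he⟩ := hsat.exists_vertex hG (by
      intro u hu
      rcases List.mem_append.1 hu with hu | hu
      · obtain ⟨v, hv, rfl⟩ := List.mem_map.1 hu
        exact ⟨(g v).2, (List.mem_append.1 hv).elim (hx v) (hy v)⟩
      · obtain ⟨v, hv, rfl⟩ := List.mem_map.1 hu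
        exact ⟨(g' v).2, hz v hv⟩) (hG.chase (f := fun v => (g v : V))
          (g := fun v => (g' v : V)) hA h₁
          -- The Chase Rule needs the same left tuple over `x` in both premises; agreement in the
          -- team is provable equality, so the Identity Rule supplies it.
          (hG.replace (f' := fun v => (g v : V))
            (fun v hv => (hq _ _).1 (hss v hv).symm) h₂))
    refine ⟨fun d => q (g'' d), ⟨g'', hg'', fun _ => rfl⟩, ?_⟩
    simp only [List.forall_mem_append, List.forall_mem_map] at he
    refine ⟨?_, ?_, ?_⟩
    · rw [canonicalTeam_map_val (g := g) hs hx,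
        canonicalTeam_map_val (g := g'') (fun _ => rfl) hx, map_eq_map_iff]
      exact fun v hv => (hq _ _).2 (he.1.1 v hv)
    · rw [canonicalTeam_map_val (g := g) hs hy,
        canonicalTeam_map_val (g := g'') (fun _ => rfl) hy, map_eq_map_iff]
      exact fun v hv => (hq _ _).2 (he.1.2 v hv)
    · rw [canonicalTeam_map_val (g := g') hs' hz,
        canonicalTeam_map_val (g := g'') (fun _ => rfl) hz, map_eq_map_iff]
      exact fun v hv => (hq _ _).2 (he.2 v hv)

theorem exists_identity_vertex (hG : Closed G) [Nonempty C] (hDC : ↑D ⊆ C) :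
    ∃ g : V → C, (∀ v ∈ D, (g v : V) = v) ∧
      pairInc (D.toList.map fun v => ((g v : V), v)) ∈ G := by
  classical
  refine ⟨fun v => if h : v ∈ D then ⟨v, hDC h⟩ else Classical.arbitrary C,
    fun v hv => by simp [hv], ?_⟩
  convert hG.refl D.toList using 2
  exact List.map_congr_left fun v hv => by simp [Finset.mem_toList.1 hv]

theorem inc_mem_of_canonicalTeam_sat (hG : Closed G)
    (hq : ∀ a b : C, q a = q b ↔ Eqv G a b) [Nonempty C] (hDC : ↑D ⊆ C) {x y : List V}
    (h : x.length = y.length) (hD : (Atom.inc x y h).vars ⊆ ↑D)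
    (hX : (canonicalTeam G D C q).Sat (.inc x y h)) : Inc x y h ∈ G := by
  have hx : ∀ v ∈ x, v ∈ D := fun v hv => hD (Or.inl hv)
  have hy : ∀ v ∈ y, v ∈ D := fun v hv => hD (Or.inr hv)
  obtain ⟨g, hgD, hg⟩ := exists_identity_vertex hG hDC
  obtain ⟨s', ⟨g', hg', hs'⟩, he⟩ := hX (fun d => q (g d)) ⟨g, hg, fun _ => rfl⟩
  rw [canonicalTeam_map_val (g := g) (fun _ => rfl) hx,
    canonicalTeam_map_val (g := g') hs' hy, map_zip_eq_iff h] at he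
  have h₁ : pairInc ((x.zip y).map fun u => ((g' u.2 : V), u.2)) ∈ G :=
    vertex_proj (g := fun v => (g' v : V)) hG hg' fun u hu => hy _ (List.of_mem_zip hu).2
  have h₂ := hG.replace (l := x.zip y) (p := []) (f' := fun u => u.1) (fun u hu => by
    have := (hq _ _).1 (he u hu).symm
    rwa [hgD _ (hx _ (List.of_mem_zip hu).1)] at this) (by simpa using h₁)
  simpa [pairInc_zip h] using h₂

/-- The Start Axiom gives `ax ⊆ ac`, hence an assignment reading `a`, `x` at `a`, `c`. It agrees
with the identity on `a`, and independence merges the two into one reading `a`, `b`, `x` at `a`,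
`b`, `c`. This is the missing premise of the Final Rule. -/
theorem ind_mem_of_canonicalTeam_sat (hG : Closed G)
    (hq : ∀ a b : C, q a = q b ↔ Eqv G a b) [Nonempty C] (hDC : ↑D ⊆ C) (hsat : Saturated G D C)
    {a b c x : List V} (h : c.length = x.length) (hD : (Atom.ind a b c).vars ⊆ ↑D)
    (hxC : ∀ v ∈ x, v ∈ C)
    (hstart : .and (Inc (a ++ c) (a ++ x) (by simp [h]))
        (.and (Ind a b x) (Inc (a ++ x) (a ++ c) (by simp [h]))) ∈ G)
    (hX : (canonicalTeam G D C q).Sat (.ind a b c)) : Ind a b c ∈ G := by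
  have ha : ∀ v ∈ a, v ∈ D := fun v hv => hD (Or.inl hv)
  have hb : ∀ v ∈ b, v ∈ D := fun v hv => hD (Or.inr (Or.inl hv))
  have hc : ∀ v ∈ c, v ∈ D := fun v hv => hD (Or.inr (Or.inr hv))
  have hac := hG _ (.andLeft hstart)
  have hind := hG _ (.andLeft (hG _ (.andRight hstart)))
  have hxc := hG _ (.andRight (hG _ (.andRight hstart)))
  obtain ⟨g, hgD, hg⟩ := exists_identity_vertex hG hDC
  rw [← pairInc_zip] at hxc
  rw [List.zip_append rfl] at hxc
  obtain ⟨g', hg', he⟩ := hsat.exists_vertex hG (p := a.zip a ++ x.zip c) (by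
    intro u hu
    rcases List.mem_append.1 hu with hu | hu
    · have := List.of_mem_zip hu
      exact ⟨hDC (ha _ this.1), ha _ this.2⟩
    · have := List.of_mem_zip hu
      exact ⟨hxC _ this.1, hc _ this.2⟩) hxc
  obtain ⟨s, ⟨g'', hg'', hs⟩, hsa, hsb, hsc⟩ := hX (fun d => q (g d)) ⟨g, hg, fun _ => rfl⟩
    (fun d => q (g' d)) ⟨g', hg', fun _ => rfl⟩ (by
      rw [canonicalTeam_map_val (g := g) (fun _ => rfl) ha,
        canonicalTeam_map_val (g := g') (fun _ => rfl) ha, map_eq_map_iff]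
      intro v hv
      rw [hq, hgD v (ha v hv)]
      exact hG.eqv_equivalence.symm (he (v, v) (List.mem_append_left _ (by
        rw [zip_self]
        exact List.mem_map_of_mem hv))))
  rw [canonicalTeam_map_val hs ha, canonicalTeam_map_val (g := g) (fun _ => rfl) ha,
    map_eq_map_iff] at hsa
  rw [canonicalTeam_map_val hs hb, canonicalTeam_map_val (g := g) (fun _ => rfl) hb,
    map_eq_map_iff] at hsb
  rw [canonicalTeam_map_val hs hc, canonicalTeam_map_val (g := g') (fun _ => rfl) hc,
    map_eq_map_iff] at hsc
  have hvert := vertex_proj (l := (a ++ b).zip (a ++ b) ++ x.zip c) (f := Prod.snd)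
    (g := fun v => (g'' v : V)) hG hg'' (by
      intro u hu
      rcases List.mem_append.1 hu with hu | hu
      · exact (List.mem_append.1 (List.of_mem_zip hu).2).elim (ha _) (hb _)
      · exact hc _ (List.of_mem_zip hu).2)
  have hfin := hG.replace (l := (a ++ b).zip (a ++ b) ++ x.zip c) (p := [])
    (f := fun u => (g'' u.2 : V)) (f' := fun u => u.1) (fun u hu => by
    rcases List.mem_append.1 hu with hu | hu
    · rw [zip_self] at hu
      obtain ⟨v, hv, rfl⟩ := List.mem_map.1 hu
      have hvD := (List.mem_append.1 hv).elim (ha v) (hb v)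
      have := (hq _ _).1 ((List.mem_append.1 hv).elim (hsa v) (hsb v))
      rwa [hgD v hvD] at this
    · exact hG.eqv_equivalence.trans ((hq _ _).1 (hsc _ (List.of_mem_zip hu).2))
        (he u (List.mem_append_right _ hu))) (by simpa using hvert)
  rw [List.append_nil, ← List.zip_append rfl, List.map_id'', pairInc_zip (by simp [h])] at hfin
  · exact hG _ (.final h (hG.and_mem hac (hG.and_mem hind hfin)))
  · exact fun _ => rfl

end Canonical

/-! ### Finite deductions as forcing conditions -/

theorem Formula.finite_vars (φ : Formula V) : φ.vars.Finite := by
  induction φ with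
  | atom A =>
    cases A with
    | inc x y h => exact x.finite_toSet.union y.finite_toSet
    | ind x y z => exact x.finite_toSet.union (y.finite_toSet.union z.finite_toSet)
  | and φ ψ h₁ h₂ => exact h₁.union h₂

theorem finite_available (S : Finset (Atom V)) (l : List (Formula V)) :
    (available S l).Finite := by
  refine Set.Finite.subset ((S.finite_toSet.image Formula.atom).union l.finite_toSet) ?_
  rintro ψ (⟨A, hA, rfl⟩ | h)
  · exact Or.inl ⟨A, hA, rfl⟩
  · exact Or.inr h

/-- A deduction from `S` whose new variables are outside `D`. -/
structure Condition (S : Finset (Atom V)) (D : Finset V) where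
  steps : List (Formula V)
  new : Set V
  deduction : Deduction S steps new
  disjoint : Disjoint (↑D) new

namespace Condition

variable {S : Finset (Atom V)} {D : Finset V}

/-- The formulas available after the deduction. -/
def formulas (s : Condition S D) : Set (Formula V) :=
  available S s.steps

/-- Only the available formulas are compared; the sequences of steps need not extend one another. -/
instance : Preorder (Condition S D) :=
  Preorder.lift formulas

theorem exists_rule (s : Condition S D) {φ : Formula V} {x : List V} (h : Rule s.formulas φ x)
    (hx : ∀ v ∈ x, v ∉ D ∧ ∀ ψ ∈ s.formulas, v ∉ ψ.vars) :
    ∃ t, s ≤ t ∧ φ ∈ t.formulas := by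
  refine ⟨⟨s.steps ++ [φ], s.new ∪ {v | v ∈ x}, s.deduction.rule h fun v hv => (hx v hv).2,
    Set.disjoint_union_right.2 ⟨s.disjoint,
      Set.disjoint_right.2 fun v hv => (hx v hv).1⟩⟩, ?_, ?_⟩
  · exact fun ψ hψ => hψ.imp_right (List.mem_append_left _)
  · exact Or.inr (by simp)

theorem exists_fresh (s : Condition S D) {C : Set V} (hC : C.Infinite) {F : Set V}
    (hF : F.Finite) : ∃ x ∈ C, x ∉ F ∧ x ∉ D ∧ ∀ ψ ∈ s.formulas, x ∉ ψ.vars := by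
  have hfin : (F ∪ ↑D ∪ ⋃ ψ ∈ s.formulas, ψ.vars).Finite :=
    (hF.union D.finite_toSet).union
      ((finite_available S s.steps).biUnion fun ψ _ => ψ.finite_vars)
  obtain ⟨x, hx, hx'⟩ := hC.exists_notMem_finite hfin
  simp only [Set.mem_union, Set.mem_iUnion, not_or, not_exists] at hx'
  exact ⟨x, hx, hx'.1.1, hx'.1.2, fun ψ hψ => hx'.2 ψ hψ⟩

theorem exists_fresh_list (s : Condition S D) {C : Set V} (hC : C.Infinite) {F : Set V}
    (hF : F.Finite) (n : ℕ) : ∃ x : List V, x.length = n ∧ x.Nodup ∧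
      ∀ v ∈ x, v ∈ C ∧ v ∉ F ∧ v ∉ D ∧ ∀ ψ ∈ s.formulas, v ∉ ψ.vars := by
  induction n with
  | zero => exact ⟨[], by simp⟩
  | succ n ih =>
    obtain ⟨x, hn, hx, h⟩ := ih
    obtain ⟨v, hv, hvF, hv'⟩ := s.exists_fresh hC (hF.union x.finite_toSet)
    simp only [Set.mem_union, not_or] at hvF
    exact ⟨v :: x, by simp [hn], List.nodup_cons.2 ⟨hvF.2, hx⟩,
      List.forall_mem_cons.2 ⟨⟨hv, hvF.1, hv'⟩, h⟩⟩

/-- Inclusion Introduction is applied once per entry of `L`, each time with a fresh variable from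
`C`. -/
theorem exists_prolong (s : Condition S D) {C : Set V} (hC : C.Infinite) (L : List V)
    (hL : ∀ v ∈ L, v ∈ D) {p : List (V × V)} (hp : pairInc p ∈ s.formulas) :
    ∃ t, s ≤ t ∧ ∃ x : List V, x.length = L.length ∧ (∀ v ∈ x, v ∈ C) ∧
      pairInc (p ++ x.zip L) ∈ t.formulas := by
  induction L generalizing s p with
  | nil => exact ⟨s, le_rfl, [], rfl, by simp, by simpa using hp⟩
  | cons d L ih =>
    obtain ⟨x, hxC, -, hxD, hx⟩ := s.exists_fresh hC Set.finite_empty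
    have hd : x ≠ d := fun h => hxD (h ▸ hL d List.mem_cons_self)
    obtain ⟨t, hst, ht⟩ := s.exists_rule (.inclusionIntro x d hd hp) (by simpa using ⟨hxD, hx⟩)
    rw [← pairInc_eq (p := p ++ [(x, d)]) _ (by simp) (by simp)] at ht
    obtain ⟨r, htr, y, hy, hyC, hr⟩ := ih t (fun v hv => hL v (List.mem_cons_of_mem _ hv)) ht
    exact ⟨r, hst.trans htr, x :: y, by simp [hy], List.forall_mem_cons.2 ⟨hxC, hyC⟩,
      by simpa using hr⟩

/-- Every extension of the deduction has an extension in which the formula is available. -/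
def Forces (s : Condition S D) (φ : Formula V) : Prop :=
  ∀ t, s ≤ t → ∃ r, t ≤ r ∧ φ ∈ r.formulas

theorem forces_of_mem {s : Condition S D} {φ : Formula V} (h : φ ∈ s.formulas) : s.Forces φ :=
  fun t ht => ⟨t, le_rfl, ht h⟩

theorem Forces.mono {s t : Condition S D} {φ : Formula V} (h : s.Forces φ) (hst : s ≤ t) :
    t.Forces φ :=
  fun r hr => h r (hst.trans hr)

theorem exists_subset_formulas {s : Condition S D} {F : Set (Formula V)} (hF : F.Finite)
    (h : ∀ φ ∈ F, s.Forces φ) : ∃ t, s ≤ t ∧ F ⊆ t.formulas := by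
  induction F, hF using Set.Finite.induction_on with
  | empty => exact ⟨s, le_rfl, Set.empty_subset _⟩
  | insert _ _ ih =>
    obtain ⟨t, hst, ht⟩ := ih fun φ hφ => h φ (Set.mem_insert_of_mem _ hφ)
    obtain ⟨r, htr, hr⟩ := h _ (Set.mem_insert _ _) t hst
    exact ⟨r, hst.trans htr, Set.insert_subset hr (ht.trans htr)⟩

/-- Finitely many forced premises become available together in one extension, where the rule can be
appended. -/
theorem closed_forces (s : Condition S D) : Closed {φ | s.Forces φ} := by
  intro φ h t hst
  obtain ⟨F, hFs, hF, hr⟩ := h.exists_finite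
  obtain ⟨r, htr, hFr⟩ := exists_subset_formulas hF fun ψ hψ => (hFs hψ).mono hst
  obtain ⟨r', hrr, h'⟩ := r.exists_rule (hr.mono hFr) (by simp)
  exact ⟨r', htr.trans hrr, h'⟩

theorem Forces.provable {s : Condition S D} {φ : Atom V} (h : s.Forces (.atom φ))
    (hD : φ.vars ⊆ ↑D) : Provable S φ := by
  obtain ⟨t, -, ht⟩ := h s le_rfl
  -- The atom may be a hypothesis or an earlier step; conjoining it with itself and eliminating
  -- makes it the last step.
  have h₁ := t.deduction.rule (.andIntro ht ht) (by simp)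
  have h₂ := h₁.rule (.andLeft (Or.inr (List.mem_append_right _ List.mem_cons_self))) (by simp)
  exact ⟨_, _, h₂, by simpa using t.disjoint.mono_left hD⟩

/-- The formulas forced by the conditions of an ideal. -/
def theory (I : Order.Ideal (Condition S D)) : Set (Formula V) :=
  {φ | ∃ s ∈ I, s.Forces φ}

theorem exists_forces_of_finite (I : Order.Ideal (Condition S D)) {F : Set (Formula V)}
    (hF : F.Finite) (h : F ⊆ theory I) : ∃ s ∈ I, ∀ φ ∈ F, s.Forces φ := by
  induction F, hF using Set.Finite.induction_on with
  | empty => exact I.nonempty.imp fun s hs => ⟨hs, by simp⟩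
  | insert _ _ ih =>
    obtain ⟨s, hs, hsF⟩ := ih ((Set.subset_insert _ _).trans h)
    obtain ⟨t, ht, htF⟩ := h (Set.mem_insert _ _)
    obtain ⟨r, hr, hsr, htr⟩ := I.directed s hs t ht
    exact ⟨r, hr, Set.forall_mem_insert.2 ⟨htF.mono htr, fun φ hφ => (hsF φ hφ).mono hsr⟩⟩

theorem closed_theory (I : Order.Ideal (Condition S D)) : Closed (theory I) := by
  intro φ h
  obtain ⟨F, hFI, hF, hr⟩ := h.exists_finite
  obtain ⟨s, hs, hsF⟩ := exists_forces_of_finite I hF hFI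
  exact ⟨s, hs, s.closed_forces φ (hr.mono hsF)⟩

/-- The conditions that force a prolongation of the inclusion `p` to `D`, or that have no
extension forcing `p`. -/
def decides (D : Finset V) (C : Set V) (p : List (V × V)) : Set (Condition S D) :=
  {s | (∃ x : List V, x.length = D.toList.length ∧ (∀ v ∈ x, v ∈ C) ∧
    s.Forces (pairInc (p ++ x.zip D.toList))) ∨ ∀ t, s ≤ t → ¬ t.Forces (pairInc p)}

theorem isCofinal_decides {C : Set V} (hC : C.Infinite) (p : List (V × V)) :
    IsCofinal (decides (S := S) D C p) := by
  intro s
  by_cases h : ∀ t, s ≤ t → ¬ t.Forces (pairInc p)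
  · exact ⟨s, Or.inr h, le_rfl⟩
  · push Not at h
    obtain ⟨t, hst, ht⟩ := h
    obtain ⟨r, htr, hr⟩ := ht t le_rfl
    obtain ⟨r', hrr, x, hx, hxC, h'⟩ := r.exists_prolong hC D.toList (by simp) hr
    exact ⟨r', Or.inl ⟨x, hx, hxC, forces_of_mem h'⟩, hst.trans (htr.trans hrr)⟩

theorem exists_saturated (s : Condition S D) {C : Set V} (hC : C.Infinite)
    (hC' : C.Countable) (hDC : ↑D ⊆ C) :
    ∃ I : Order.Ideal (Condition S D), s ∈ I ∧ Saturated (theory I) D C := by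
  classical
  have := hC'.to_subtype
  have := hC.to_subtype
  let _ : Encodable (List (C × C)) := Encodable.ofCountable _
  let 𝒟 : List (C × C) → Order.Cofinal (Condition S D) := fun p =>
    ⟨decides D C (p.map fun u => (u.1, u.2)), isCofinal_decides hC _⟩
  refine ⟨Order.idealOfCofinals s 𝒟, Order.mem_idealOfCofinals s 𝒟, fun p hp ⟨t, ht, h⟩ => ?_⟩
  obtain ⟨p, rfl⟩ : ∃ p' : List (C × C), p'.map (fun u => ((u.1 : V), (u.2 : V))) = p := by
    refine ⟨p.attach.map fun u => (⟨u.1.1, (hp u.1 u.2).1⟩, ⟨u.1.2, hDC (hp u.1 u.2).2⟩), ?_⟩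
    rw [List.map_map]
    exact p.attach_map_subtype_val
  obtain ⟨r, hr, hrI⟩ := Order.cofinal_meets_idealOfCofinals s 𝒟 p
  rcases hr with ⟨x, hx, hxC, hr⟩ | hr
  · refine ⟨fun v => if h : v ∈ D then ⟨x[D.toList.idxOf v]'(by
      rw [hx]; exact List.idxOf_lt_length_iff.2 (Finset.mem_toList.2 h)), hxC _ (by simp)⟩
      else Classical.arbitrary C, r, hrI, ?_⟩
    convert hr using 3
    refine List.ext_getElem (by simp [hx]) fun i h₁ h₂ => ?_
    have hi : D.toList[i]'(by simpa using h₁) ∈ D := Finset.mem_toList.1 (by simp)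
    simp [hi, D.nodup_toList.idxOf_getElem]
  -- A common upper bound of `t` and `r` in the ideal forces `p`, contrary to the second
  -- alternative.
  · obtain ⟨r', -, htr, hrr⟩ := (Order.idealOfCofinals s 𝒟).directed t ht r hrI
    exact (hr r' hrr (h.mono htr)).elim

end Condition

theorem exists_naming {G : Set (Formula V)} (hG : Closed G) {C : Set V} (hC : C.Countable) :
    ∃ q : C → ULift.{w} ℕ, ∀ a b : C, q a = q b ↔ Eqv G a b := by
  have := hC.to_subtype
  let r : Setoid C := ⟨fun a b => Eqv G a b, hG.eqv_equivalence.comap _⟩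
  -- The classes of provable equality are countably many, so natural numbers suffice as values of
  -- the team.
  obtain ⟨f, hf⟩ := exists_injective_nat (Quotient r)
  refine ⟨fun a => ⟨f (Quotient.mk r a)⟩, fun a b => ?_⟩
  rw [ULift.up_inj, hf.eq_iff]
  exact Quotient.eq

theorem Entails.provable [Infinite V] {S : Finset (Atom V)} {φ : Atom V}
    (h : Entails.{u, w} S φ) : Provable S φ := by
  classical
  have hfin : (φ.vars ∪ ⋃ A ∈ S, A.vars).Finite :=
    (Formula.atom φ).finite_vars.union
      (S.finite_toSet.biUnion fun A _ => (Formula.atom A).finite_vars)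
  obtain ⟨D, hD⟩ := hfin.exists_finset_coe
  have hφ : φ.vars ⊆ ↑D := hD ▸ Set.subset_union_left
  have hS : ∀ A ∈ S, A.vars ⊆ ↑D := fun A hA =>
    hD ▸ (Set.subset_biUnion_of_mem (u := Atom.vars) hA).trans Set.subset_union_right
  -- Countability leaves only countably many dense sets to meet; infinity provides fresh variables
  -- inside `C`.
  let C : Set V := ↑D ∪ Set.range (Infinite.natEmbedding V)
  have hDC : ↑D ⊆ C := Set.subset_union_left
  have hC : C.Infinite :=
    (Set.infinite_range_of_injective (Infinite.natEmbedding V).injective).mono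
      Set.subset_union_right
  have hC' : C.Countable := D.countable_toSet.union (Set.countable_range _)
  have := hC.nonempty.to_subtype
  -- The starting condition stays arbitrary: the empty deduction serves for inclusions, an instance
  -- of the Start Axiom for independence.
  have key : ∀ s : Condition S D, ∃ (I : Order.Ideal (Condition S D)) (q : C → ULift.{w} ℕ),
      s ∈ I ∧ Saturated (Condition.theory I) D C ∧
      (∀ a b : C, q a = q b ↔ Eqv (Condition.theory I) a b) ∧
      (canonicalTeam (Condition.theory I) D C q).Sat φ := by
    intro s
    obtain ⟨I, hs, hI⟩ := s.exists_saturated hC hC' hDC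
    obtain ⟨q, hq⟩ := exists_naming.{u, w} (Condition.closed_theory I) hC'
    refine ⟨I, q, hs, hI, hq, h _ _ hS hφ fun A hA => ?_⟩
    exact canonicalTeam_sat (Condition.closed_theory I) hq hI
      ⟨s, hs, Condition.forces_of_mem (Or.inl ⟨A, hA, rfl⟩)⟩ (hS A hA)
  let s : Condition S D := ⟨[], ∅, .nil, by simp⟩
  cases φ with
  | inc x y hxy =>
    obtain ⟨I, q, -, -, hq, hX⟩ := key s
    obtain ⟨t, -, ht⟩ :=
      inc_mem_of_canonicalTeam_sat (Condition.closed_theory I) hq hDC hxy hφ hX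
    exact ht.provable hφ
  | ind a b c =>
    obtain ⟨x, hx, hn, hxs⟩ := s.exists_fresh_list hC Set.finite_empty c.length
    obtain ⟨s', -, hs'⟩ := s.exists_rule
      (.start a b c x hx.symm hn fun v hv => by
        have hvD := (hxs v hv).2.2.1
        exact ⟨fun h' => hvD (hφ (Or.inl h')), fun h' => hvD (hφ (Or.inr (Or.inl h'))),
          fun h' => hvD (hφ (Or.inr (Or.inr h')))⟩) fun v hv => (hxs v hv).2.2
    obtain ⟨I, q, hsI, hI, hq, hX⟩ := key s'
    obtain ⟨t, -, ht⟩ := ind_mem_of_canonicalTeam_sat (Condition.closed_theory I) hq hDC hI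
      hx.symm hφ (fun v hv => (hxs v hv).1) ⟨s', hsI, Condition.forces_of_mem hs'⟩ hX
    exact ht.provable hφ

end IndInc

theorem mainTheorem1 {V : Type u} [Infinite V] (S : Finset (IndInc.Atom V)) (φ : IndInc.Atom V)
    (h : IndInc.Entails.{u, w} S φ) : IndInc.Provable S φ := by
  exact h.provable
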